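/- Let $T$ be a rank-one cutting-and-stacking transformation: $C_0$ is the single interval $[0,1)$; for every $n\ge 0$ the column $C_{n+1}$ is obtained from the column $C_n$ (an ordered list of $h_n$ pairwise disjoint half-open intervals of equal length, called levels, with heights $0,\dots,h_n-1$) by cutting it into $r_n\ge 2$ subcolumns of equal width, adding $s_{n,k}\ge 0$ new levels (intervals of the same width, disjoint from all the others) above the $k$-th subcolumn, $0\le k<r_n$, and stacking every subcolumn under the subcolumn to its right. Let $X\subset\mathbb{R}$ be the union of all levels of all columns, with Lebesgue measure $\mu$, and let $T\colon X\to X$ be the pointwise limit of the column maps, which translate each non-top level of $C_n$ onto the level above it. For the base (bottom level) $I$ of $C_i$ and $j\ge i$, let $D(I,j)\subset\{0,\dots,h_j-1\}$ be the set of heights of those levels of $C_j$ that are contained in $I$. Suppose that for every $\varepsilon>0$, every integer $i\ge 0$ with $I$ the base of $C_i$, and every integer $b$ with $0\le b<h_i-1$, there are an integer $j>i$, a set $F\subset D(I,j)^2$ with $|F|\ge(1-\varepsilon)|D(I,j)|^2$, and an injective map $F\to D(I,j)^2$, $(a,a')\mapsto(d,d')$, such that $a-d=a'-d'-b$ for all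 $(a,a')\in F$. Then $T\times T$ is conservative and ergodic with respect to $\mu\times\mu$. -/

import Mathlib

open MeasureTheory

/-- Number of levels `h n` of the column `C n`, for cutting parameters `r n` (number of subcolumns)
and spacer parameters `s n k` (number of spacers above the `k`-th subcolumn, `k < r n`). -/
def rankOneHeight (r : ℕ → ℕ) (s : ℕ → ℕ → ℕ) : ℕ → ℕ
  | 0 => 1
  | n + 1 => ∑ k ∈ Finset.range (r n), (rankOneHeight r s n + s n k)

/-- Height in `C (n + 1)` of the bottom of the `k`-th subcolumn of `C n`: each of the subcolumns
to its left contributes its `h n` levels and the spacers above it. -/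
def rankOneOffset (r : ℕ → ℕ) (s : ℕ → ℕ → ℕ) (n k : ℕ) : ℕ :=
  ∑ l ∈ Finset.range k, (rankOneHeight r s n + s n l)

/-- Common length of the levels of `C n`. -/
noncomputable def rankOneWidth (r : ℕ → ℕ) (n : ℕ) : ℝ :=
  ∏ k ∈ Finset.range n, (1 / (r k : ℝ))

/-- A rank-one cutting-and-stacking construction. Levels are half-open intervals `[x, x + w)` of
the real line; `left n m` is the left end point of the level at height `m` (counted from `0`) of the
column `C n`. -/
structure RankOneConstruction where
  /-- number of subcolumns into which `C n` is cut -/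
  r : ℕ → ℕ
  /-- number of spacers put above the `k`-th subcolumn of `C n` (used for `k < r n` only) -/
  s : ℕ → ℕ → ℕ
  /-- left end points of the levels (used for heights below `h n` only) -/
  left : ℕ → ℕ → ℝ
  two_le_r : ∀ n, 2 ≤ r n
  /-- `C 0` consists of the unit interval only. -/
  left_zero : left 0 0 = 0
  /-- `C (n + 1)` contains the `r n` subcolumns of `C n`, cut from left to right, each one below the
  subcolumn to its right; the remaining positions are the spacers, which are arbitrary. -/
  left_succ : ∀ n k m, k < r n → m < rankOneHeight r s n →
    left (n + 1) (rankOneOffset r s n k + m) = left n m + k * rankOneWidth r (n + 1)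
  /-- The levels of a column are pairwise disjoint (so that spacers are new intervals). -/
  disjoint_levels : ∀ n m m', m < rankOneHeight r s n → m' < rankOneHeight r s n → m ≠ m' →
    Disjoint (Set.Ico (left n m) (left n m + rankOneWidth r n))
      (Set.Ico (left n m') (left n m' + rankOneWidth r n))

namespace RankOneConstruction

/-- The number of levels of `C n`. -/
def height (C : RankOneConstruction) (n : ℕ) : ℕ := rankOneHeight C.r C.s n

/-- The level at height `m` of the column `C n`, for `m < C.height n`. -/
def level (C : RankOneConstruction) (n m : ℕ) : Set ℝ :=
  Set.Ico (C.left n m) (C.left n m + rankOneWidth C.r n)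

/-- The space: the union of all the levels of all the columns. -/
def space (C : RankOneConstruction) : Set ℝ :=
  ⋃ n, ⋃ m ∈ Finset.range (C.height n), C.level n m

/-- Lebesgue measure on the space. -/
noncomputable def measure (C : RankOneConstruction) : Measure ℝ :=
  volume.restrict C.space

open Classical in
/-- The column map: it translates each level of `C n` but the top one onto the level above it.
Where it is not defined, we let it fix the point. -/
noncomputable def columnMap (C : RankOneConstruction) (n : ℕ) (x : ℝ) : ℝ :=
  if hx : ∃ m, m + 1 < C.height n ∧ x ∈ C.level n m then
    C.left n (hx.choose + 1) + (x - C.left n hx.choose)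
  else x

/-- The rank-one transformation: the pointwise limit of the column maps, which at each point of the
space form an eventually constant sequence. (Points outside the space are fixed.) -/
noncomputable def transformation (C : RankOneConstruction) (x : ℝ) : ℝ :=
  Filter.limUnder Filter.atTop (fun n => C.columnMap n x)

open Classical in
/-- Heights in `C j` of the descendants of the level at height `m` of `C i`, that is, of the levels
of `C j` that make up that level. -/
noncomputable def descendants (C : RankOneConstruction) (i m j : ℕ) : Finset ℕ :=
  (Finset.range (C.height j)).filter (fun a => C.level j a ⊆ C.level i m)

/-- At least `(1 - ε) |D|²` of the pairs `(a, a')` in `D × D`, where `D` is the set of heights in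
`C j` of the descendants of the base of `C i`, have uniquely corresponding pairs `(d, d')` in
`D × D` with `a - d = a' - d' - b`: different `(a, a')` have different `(d, d')`. -/
def HasUniquePairs (C : RankOneConstruction) (ε : ℝ) (i b j : ℕ) : Prop :=
  ∃ F ⊆ C.descendants i 0 j ×ˢ C.descendants i 0 j,
    (1 - ε) * ((C.descendants i 0 j).card : ℝ) ^ 2 ≤ (F.card : ℝ) ∧
    ∃ φ : ℕ × ℕ → ℕ × ℕ, Set.InjOn φ (F : Set (ℕ × ℕ)) ∧
      ∀ p ∈ F, φ p ∈ C.descendants i 0 j ×ˢ C.descendants i 0 j ∧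
        (p.1 : ℤ) - ((φ p).1 : ℤ) = (p.2 : ℤ) - ((φ p).2 : ℤ) - (b : ℤ)

end RankOneConstruction

/-! Let `A` be invariant under `T × T`, and let its mass at `(p, q)` be its area inside the product
of levels `p` and `q` of a column. Away from the top levels `T × T` translates such products along
the diagonal, so within one column the mass depends only on `p - q` (`mass_eq_of_sub_eq_sub`).

The hypothesis compares different diagonals. Split level `b` times the base of `C i` into products
at `(a + b, a')` in `C j`, with `a`, `a'` in `D(I, j)`. The relation `a - d = a' - d' - b` puts `(a
+ b, a')` on the diagonal of `(d, d')`, a piece of base times base. Since the pairing is injective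
and misses only an `ε`-fraction of pairs, mass at `(b, 0)` exceeds mass at `(0, 0)` by at most `ε`
times the area (`mass_le_of_hasUniquePairs`). Letting `ε` tend to `0` and treating `Aᶜ` likewise
gives equality (`mass_base_right`).

Hence `A` has one density `ρ` in all products of two non-top levels, in all columns
(`exists_mass_eq_mul`). These products generate the Borel sets of the square of the space, so the
product measure restricted to `A` is `ρ` times itself (`exists_restrict_eq_smul`). Evaluating at
`Aᶜ` shows that `A` is null or conull. Conservativity then follows from ergodicity, as `T × T` is
injective and its measure has no atoms. -/

/-! ### Ergodic implies conservative -/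

open Filter in
/-- An ergodic measurable embedding of a space with an atomless measure is conservative. -/
theorem Ergodic.conservative_of_measurableEmbedding {α : Type*} [MeasurableSpace α]
    [MeasurableSpace.CountablySeparated α] [Nonempty α] {μ : Measure α} [NullSingletonClass μ] {f : α → α}
    (hf : Ergodic f μ) (hemb : MeasurableEmbedding f) : Conservative f μ := by
  refine ⟨hf.toMeasurePreserving.quasiMeasurePreserving, fun s hs h0 => ?_⟩
  by_contra! hret
  have hinj : ∀ n, Function.Injective f^[n] := hemb.injective.iterate
  have hmeas_image : ∀ n, ∀ u : Set α, MeasurableSet u → MeasurableSet (f^[n] '' u) := by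
    intro n
    induction n with
    | zero => simp
    | succ n ih =>
      intro u hu
      rw [Function.iterate_succ, Set.image_comp]
      exact ih _ (hemb.measurableSet_image.2 hu)
  -- a measurable part of the wandering set `s` is null or conull in it
  have hdich : ∀ u : Set α, MeasurableSet u →
      (∀ᵐ x ∂μ.restrict s, x ∈ u) ∨ ∀ᵐ x ∂μ.restrict s, x ∉ u := by
    intro u hu
    -- The saturation of `s ∩ u` under the orbit relation. The two exponents replace an inverse of
    -- `f` and make it strictly invariant.
    set G : Set α := ⋃ n : ℕ, ⋃ m : ℕ, f^[n] ⁻¹' (f^[m] '' (s ∩ u)) with hG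
    have mem_G : ∀ x, x ∈ G ↔ ∃ n m, ∃ y ∈ s ∩ u, f^[m] y = f^[n] x := fun x => by
      simp only [hG, Set.mem_iUnion, Set.mem_preimage, Set.mem_image]
    have hGm : MeasurableSet G := .iUnion fun n => .iUnion fun m =>
      (hemb.measurable.iterate n) (hmeas_image m _ (hs.inter hu))
    have hGinv : f ⁻¹' G = G := by
      ext x
      rw [Set.mem_preimage, mem_G, mem_G]
      constructor
      · rintro ⟨n, m, y, hy, h⟩
        exact ⟨n + 1, m, y, hy, h⟩
      · rintro ⟨n, m, y, hy, h⟩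
        refine ⟨n, m + 1, y, hy, ?_⟩
        rw [Function.iterate_succ_apply', h, ← Function.iterate_succ_apply' f,
          Function.iterate_succ_apply]
    -- By injectivity, two points of `s` on one orbit are iterates of each other; as `s` is
    -- wandering, they coincide.
    have hGs : ∀ x ∈ s, x ∈ G → x ∈ u := by
      intro x hx hxG
      obtain ⟨n, m, y, hy, h⟩ := (mem_G x).1 hxG
      have hxy : y = x := by
        rcases lt_trichotomy n m with hlt | rfl | hlt
        · obtain ⟨k, rfl⟩ := Nat.exists_eq_add_of_lt hlt
          rw [add_assoc, Function.iterate_add_apply] at h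
          exact absurd ((hinj n h) ▸ hx) (hret y hy.1 _ (Nat.succ_ne_zero k))
        · exact hinj n h
        · obtain ⟨k, rfl⟩ := Nat.exists_eq_add_of_lt hlt
          rw [add_assoc, Function.iterate_add_apply] at h
          exact absurd ((hinj m h).symm ▸ hy.1) (hret x hx _ (Nat.succ_ne_zero k))
      exact hxy ▸ hy.2
    have hself : ∀ x ∈ s, x ∈ u → x ∈ G := fun x hx hxu =>
      (mem_G x).2 ⟨0, 0, x, ⟨hx, hxu⟩, rfl⟩
    rcases eventuallyConst_set.1 (hf.aeconst_set hGm hGinv) with h | h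
    · left
      rw [ae_restrict_iff' hs]
      exact h.mono fun x hx hxs => hGs x hxs hx
    · right
      rw [ae_restrict_iff' hs]
      exact h.mono fun x hx hxs hxu => hx (hself x hxs hxu)
  -- With this dichotomy and countable separation, the measure on `s` is carried by a single point,
  -- which is null.
  obtain ⟨a, ha⟩ := exists_eventuallyEq_const_of_forall_separating (l := ae (μ.restrict s))
    (f := id) MeasurableSet hdich
  have hnull : μ.restrict s {a} = 0 := measure_singleton a
  apply h0
  rw [← Measure.restrict_apply_univ, ← nonpos_iff_eq_zero, ← hnull]
  exact measure_mono_ae (ha.mono fun x hx _ => hx)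

/-! ### Widths, heights and nesting of levels -/

namespace RankOneConstruction

variable (C : RankOneConstruction) {i j n m a k : ℕ} {x : ℝ}

lemma rankOneWidth_pos (n : ℕ) : 0 < rankOneWidth C.r n :=
  Finset.prod_pos fun k _ => by
    have : 0 < C.r k := by have := C.two_le_r k; omega
    positivity

lemma rankOneWidth_succ (n : ℕ) : C.r n * rankOneWidth C.r (n + 1) = rankOneWidth C.r n := by
  have : (C.r n : ℝ) ≠ 0 := by have := C.two_le_r n; positivity
  simp only [rankOneWidth, Finset.prod_range_succ]
  field_simp

lemma rankOneWidth_le (n : ℕ) : rankOneWidth C.r n ≤ (1 / 2) ^ n := by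
  induction n with
  | zero => simp [rankOneWidth]
  | succ n ih =>
    have h1 := C.rankOneWidth_succ n
    have h2 : (2 : ℝ) ≤ C.r n := by exact_mod_cast C.two_le_r n
    have h3 := C.rankOneWidth_pos (n + 1)
    have h4 := mul_le_mul_of_nonneg_right h2 h3.le
    rw [pow_succ]
    linarith

lemma tendsto_rankOneWidth :
    Filter.Tendsto (rankOneWidth C.r) Filter.atTop (nhds 0) :=
  squeeze_zero (fun n => (C.rankOneWidth_pos n).le) C.rankOneWidth_le
    (tendsto_pow_atTop_nhds_zero_of_lt_one (by norm_num) (by norm_num))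

lemma height_zero : C.height 0 = 1 := by simp [height, rankOneHeight]

lemma height_succ (n : ℕ) : C.height (n + 1) = rankOneOffset C.r C.s n (C.r n) := by
  simp [height, rankOneHeight, rankOneOffset]

lemma rankOneOffset_add_height_le (n k : ℕ) :
    rankOneOffset C.r C.s n k + C.height n ≤ rankOneOffset C.r C.s n (k + 1) := by
  simp only [rankOneOffset, Finset.sum_range_succ, height]
  omega

lemma rankOneOffset_mono (n : ℕ) : Monotone (rankOneOffset C.r C.s n) :=
  monotone_nat_of_le_succ fun k => (Nat.le_add_right _ _).trans (C.rankOneOffset_add_height_le n k)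

lemma two_mul_height_le (n : ℕ) : 2 * C.height n ≤ C.height (n + 1) := by
  have h1 := C.rankOneOffset_add_height_le n 0
  have h2 := C.rankOneOffset_add_height_le n 1
  have h3 := C.rankOneOffset_mono n (C.two_le_r n)
  rw [← height_succ] at h3
  simp only [zero_add, one_add_one_eq_two] at h1 h2
  omega

lemma height_pos (n : ℕ) : 0 < C.height n := by
  induction n with
  | zero => simp [height_zero]
  | succ n ih => have := C.two_mul_height_le n; omega

lemma two_le_height (hn : 1 ≤ n) : 2 ≤ C.height n := by
  obtain ⟨n, rfl⟩ := Nat.exists_eq_add_of_le' hn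
  have := C.two_mul_height_le n
  have := C.height_pos n
  omega

lemma rankOneOffset_add_lt (hk : k < C.r n) (hm : m < C.height n) :
    rankOneOffset C.r C.s n k + m < C.height (n + 1) := by
  have h1 := C.rankOneOffset_add_height_le n k
  have h2 := C.rankOneOffset_mono n (Nat.succ_le_of_lt hk)
  rw [height_succ]
  simp only [Nat.succ_eq_add_one] at h2
  omega

variable {C}

lemma mem_level : x ∈ C.level n m ↔ C.left n m ≤ x ∧ x < C.left n m + rankOneWidth C.r n :=
  Iff.rfl

lemma eq_of_mem_level {m' : ℕ} (hm : m < C.height n) (hm' : m' < C.height n)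
    (hx : x ∈ C.level n m) (hx' : x ∈ C.level n m') : m = m' := by
  by_contra h
  exact Set.disjoint_left.1 (C.disjoint_levels n m m' hm hm' h) hx hx'

lemma level_succ_subset (hk : k < C.r n) (hm : m < C.height n) :
    C.level (n + 1) (rankOneOffset C.r C.s n k + m) ⊆ C.level n m := by
  have h1 := C.rankOneWidth_succ n
  have h2 := C.rankOneWidth_pos (n + 1)
  have h3 : (k : ℝ) + 1 ≤ C.r n := by exact_mod_cast hk
  have h4 := mul_le_mul_of_nonneg_right h3 h2.le
  intro x hx
  rw [mem_level, C.left_succ n k m hk hm] at hx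
  rw [mem_level]
  have : 0 ≤ (k : ℝ) * rankOneWidth C.r (n + 1) := by positivity
  constructor <;> linarith

lemma exists_mem_level_succ (hm : m < C.height n) (hx : x ∈ C.level n m) :
    ∃ k < C.r n, x ∈ C.level (n + 1) (rankOneOffset C.r C.s n k + m) := by
  have h1 := C.rankOneWidth_succ n
  have h2 := C.rankOneWidth_pos (n + 1)
  rw [mem_level] at hx
  have h0 : 0 ≤ (x - C.left n m) / rankOneWidth C.r (n + 1) :=
    div_nonneg (by linarith) h2.le
  have hlt : ⌊(x - C.left n m) / rankOneWidth C.r (n + 1)⌋₊ < C.r n := by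
    rw [Nat.floor_lt h0, div_lt_iff₀ h2]
    linarith
  refine ⟨_, hlt, ?_⟩
  rw [mem_level, C.left_succ n _ m hlt hm]
  have h3 := Nat.floor_le h0
  have h4 := Nat.lt_floor_add_one ((x - C.left n m) / rankOneWidth C.r (n + 1))
  rw [le_div_iff₀ h2] at h3
  rw [div_lt_iff₀ h2] at h4
  constructor <;> linarith

lemma exists_mem_level (hij : i ≤ j) (hm : m < C.height i) (hx : x ∈ C.level i m) :
    ∃ a < C.height j, x ∈ C.level j a := by
  induction j, hij using Nat.le_induction with
  | base => exact ⟨m, hm, hx⟩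
  | succ j _ ih =>
    obtain ⟨a, ha, hxa⟩ := ih
    obtain ⟨k, hk, hxk⟩ := exists_mem_level_succ ha hxa
    exact ⟨_, C.rankOneOffset_add_lt hk ha, hxk⟩

/-- A level of `C j` meeting a level of `C i`, where `i ≤ j`, sits in a subcolumn of `C (j - 1)`. -/
lemma exists_eq_rankOneOffset_add (hij : i ≤ j) (hm : m < C.height i) (ha : a < C.height (j + 1))
    (hx : x ∈ C.level i m) (hxa : x ∈ C.level (j + 1) a) :
    ∃ k < C.r j, ∃ c < C.height j, x ∈ C.level j c ∧ a = rankOneOffset C.r C.s j k + c := by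
  obtain ⟨c, hc, hxc⟩ := exists_mem_level hij hm hx
  obtain ⟨k, hk, hxk⟩ := exists_mem_level_succ hc hxc
  exact ⟨k, hk, c, hc, hxc, eq_of_mem_level ha (C.rankOneOffset_add_lt hk hc) hxa hxk⟩

lemma level_subset_of_mem (hij : i ≤ j) (hm : m < C.height i) (ha : a < C.height j)
    (hx : x ∈ C.level i m) (hxa : x ∈ C.level j a) : C.level j a ⊆ C.level i m := by
  induction j, hij using Nat.le_induction generalizing a with
  | base => rw [eq_of_mem_level hm ha hx hxa]
  | succ j hij ih =>
    obtain ⟨k, hk, c, hc, hxc, rfl⟩ := exists_eq_rankOneOffset_add hij hm ha hx hxa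
    exact (level_succ_subset hk hc).trans (ih hc hxc)

/-- Above a level of `C j` that meets a non-top level of `C i`, where `i ≤ j`, the columns `C i` and
`C j` continue by the same translation. -/
lemma left_add_one_sub_left (hij : i ≤ j) (hm : m + 1 < C.height i) (ha : a < C.height j)
    (hx : x ∈ C.level i m) (hxa : x ∈ C.level j a) :
    a + 1 < C.height j ∧ C.left j (a + 1) - C.left j a = C.left i (m + 1) - C.left i m := by
  induction j, hij using Nat.le_induction generalizing a with
  | base =>
    obtain rfl := eq_of_mem_level (Nat.lt_of_succ_lt hm) ha hx hxa
    exact ⟨hm, rfl⟩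
  | succ j hij ih =>
    obtain ⟨k, hk, c, hc, hxc, rfl⟩ :=
      exists_eq_rankOneOffset_add hij (Nat.lt_of_succ_lt hm) ha hx hxa
    obtain ⟨h1, h2⟩ := ih hc hxc
    refine ⟨C.rankOneOffset_add_lt hk h1, ?_⟩
    rw [add_assoc, C.left_succ j k _ hk h1, C.left_succ j k _ hk hc, ← h2]
    ring

lemma mem_space : x ∈ C.space ↔ ∃ n, ∃ m < C.height n, x ∈ C.level n m := by
  simp [space]

lemma level_subset_space (hm : m < C.height n) : C.level n m ⊆ C.space :=
  fun _ hx => mem_space.2 ⟨n, m, hm, hx⟩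

lemma left_mem_level (n m : ℕ) : C.left n m ∈ C.level n m :=
  ⟨le_rfl, lt_add_of_pos_right _ (C.rankOneWidth_pos n)⟩

/-- Every point of the space eventually leaves the top level. -/
lemma exists_mem_level_add_one_lt (hx : x ∈ C.space) :
    ∃ n m, m + 1 < C.height n ∧ x ∈ C.level n m := by
  by_contra! hcon
  obtain ⟨N, m, hm, hxm⟩ := mem_space.1 hx
  -- A point always in the top level always falls in the last subcolumn, so the right end point of
  -- its level never changes. As the widths tend to `0`, the point would have to equal that excluded
  -- end point.
  have key : ∀ n, N ≤ n → ∃ c, c + 1 = C.height n ∧ x ∈ C.level n c ∧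
      C.left n c + rankOneWidth C.r n = C.left N m + rankOneWidth C.r N := by
    intro n hn
    induction n, hn using Nat.le_induction with
    | base =>
      refine ⟨m, ?_, hxm, rfl⟩
      have := mt (hcon N m) (not_not.2 hxm)
      omega
    | succ n hn ih =>
      obtain ⟨c, hc, hxc, hr⟩ := ih
      obtain ⟨k, hk, hxk⟩ := exists_mem_level_succ (by omega) hxc
      have h1 := C.rankOneOffset_add_lt hk (show c < C.height n by omega)
      have h2 := mt (hcon (n + 1) _) (not_not.2 hxk)
      have h3 : k + 1 = C.r n := by
        by_contra hne
        have h4 := C.rankOneOffset_add_height_le n k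
        have h5 := C.rankOneOffset_add_lt (n := n) (k := k + 1) (m := 0) (by omega)
          (C.height_pos n)
        omega
      refine ⟨_, by omega, hxk, ?_⟩
      rw [C.left_succ n k c hk (show c < C.height n by omega), ← hr, ← C.rankOneWidth_succ n, ← h3]
      push_cast
      ring
  have hlt := hxm.2
  obtain ⟨n, hn, hNn⟩ := ((C.tendsto_rankOneWidth.eventually_lt_const
    (sub_pos.2 hlt)).and (Filter.eventually_ge_atTop N)).exists
  obtain ⟨c, -, hxc, hr⟩ := key n hNn
  rw [mem_level] at hxc
  linarith

/-- Compatibility of the columns: it makes the column maps eventually constant at each point and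
lets several points be viewed in one column. -/
lemma exists_mem_level_add_one_lt_of_le (hij : i ≤ j) (hm : m + 1 < C.height i)
    (hx : x ∈ C.level i m) :
    ∃ a, a + 1 < C.height j ∧ x ∈ C.level j a ∧
      C.left j (a + 1) - C.left j a = C.left i (m + 1) - C.left i m := by
  obtain ⟨a, ha, hxa⟩ := exists_mem_level hij (Nat.lt_of_succ_lt hm) hx
  obtain ⟨h1, h2⟩ := left_add_one_sub_left hij hm ha hx hxa
  exact ⟨a, h1, hxa, h2⟩

end RankOneConstruction

/-! ### The transformation is measurable, injective and measure preserving -/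

namespace RankOneConstruction

variable {C : RankOneConstruction} {i j n m a k : ℕ} {x : ℝ}

lemma columnMap_of_mem (hm : m + 1 < C.height n) (hx : x ∈ C.level n m) :
    C.columnMap n x = x + (C.left n (m + 1) - C.left n m) := by
  have h : ∃ m, m + 1 < C.height n ∧ x ∈ C.level n m := ⟨m, hm, hx⟩
  have h1 : h.choose = m :=
    eq_of_mem_level (Nat.lt_of_succ_lt h.choose_spec.1) (Nat.lt_of_succ_lt hm) h.choose_spec.2 hx
  rw [columnMap, dif_pos h, h1]
  ring

lemma columnMap_of_forall_notMem (h : ∀ m, m + 1 < C.height n → x ∉ C.level n m) :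
    C.columnMap n x = x := by
  rw [columnMap, dif_neg]
  push Not
  exact h

lemma eventually_columnMap_of_mem (hm : m + 1 < C.height n) (hx : x ∈ C.level n m) :
    ∀ᶠ j in Filter.atTop, C.columnMap j x = x + (C.left n (m + 1) - C.left n m) := by
  filter_upwards [Filter.eventually_ge_atTop n] with j hj
  obtain ⟨a, ha, hxa, h⟩ := exists_mem_level_add_one_lt_of_le hj hm hx
  rw [columnMap_of_mem ha hxa, h]

lemma columnMap_of_notMem_space (hx : x ∉ C.space) (n : ℕ) : C.columnMap n x = x :=
  columnMap_of_forall_notMem fun _ hm h =>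
    hx (level_subset_space (Nat.lt_of_succ_lt hm) h)

lemma transformation_of_mem (hm : m + 1 < C.height n) (hx : x ∈ C.level n m) :
    C.transformation x = x + (C.left n (m + 1) - C.left n m) :=
  (tendsto_const_nhds.congr' ((eventually_columnMap_of_mem hm hx).mono fun _ h => h.symm)).limUnder_eq

lemma transformation_of_notMem_space (hx : x ∉ C.space) : C.transformation x = x := by
  simp only [transformation, columnMap_of_notMem_space hx]
  exact tendsto_const_nhds.limUnder_eq

lemma tendsto_columnMap (C : RankOneConstruction) (x : ℝ) :
    Filter.Tendsto (fun n => C.columnMap n x) Filter.atTop (nhds (C.transformation x)) := by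
  by_cases hx : x ∈ C.space
  · obtain ⟨n, m, hm, hxm⟩ := exists_mem_level_add_one_lt hx
    rw [transformation_of_mem hm hxm]
    exact tendsto_const_nhds.congr'
      ((eventually_columnMap_of_mem hm hxm).mono fun _ h => h.symm)
  · simp only [transformation_of_notMem_space hx, columnMap_of_notMem_space hx]
    exact tendsto_const_nhds

lemma measurableSet_level (n m : ℕ) : MeasurableSet (C.level n m) := measurableSet_Ico

lemma measurableSet_space (C : RankOneConstruction) : MeasurableSet C.space :=
  .iUnion fun _ => .biUnion (Finset.countable_toSet _) fun _ _ => measurableSet_level _ _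

lemma measurable_columnMap (C : RankOneConstruction) (n : ℕ) : Measurable (C.columnMap n) := by
  have h : C.columnMap n = fun x => x + ∑ m ∈ Finset.range (C.height n - 1),
      (C.level n m).indicator (fun _ => C.left n (m + 1) - C.left n m) x := by
    funext x
    by_cases h : ∃ m, m + 1 < C.height n ∧ x ∈ C.level n m
    · obtain ⟨m, hm, hx⟩ := h
      rw [columnMap_of_mem hm hx, Finset.sum_eq_single m, Set.indicator_of_mem hx]
      · intro c hc hne
        refine Set.indicator_of_notMem (fun hxc => hne ?_) _
        rw [Finset.mem_range] at hc
        exact eq_of_mem_level (by omega) (by omega) hxc hx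
      · intro h
        rw [Finset.mem_range] at h
        omega
    · push Not at h
      rw [columnMap_of_forall_notMem h, Finset.sum_eq_zero, add_zero]
      intro c hc
      rw [Finset.mem_range] at hc
      exact Set.indicator_of_notMem (h c (by omega)) _
  rw [h]
  exact measurable_id.add (Finset.measurable_fun_sum _ fun m _ =>
    measurable_const.indicator (measurableSet_level n m))

lemma measurable_transformation (C : RankOneConstruction) : Measurable C.transformation :=
  measurable_of_tendsto_metrizable (measurable_columnMap C)
    (tendsto_pi_nhds.2 (tendsto_columnMap C))

lemma add_mem_level_iff {c : ℝ} (h : c = C.left n a - C.left n m) :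
    x + c ∈ C.level n a ↔ x ∈ C.level n m := by
  subst h
  simp only [mem_level]
  constructor <;> rintro ⟨h1, h2⟩ <;> constructor <;> linarith

lemma transformation_mem_level (hm : m + 1 < C.height n) (hx : x ∈ C.level n m) :
    C.transformation x ∈ C.level n (m + 1) := by
  rw [transformation_of_mem hm hx]
  exact (add_mem_level_iff rfl).2 hx

lemma transformation_mem_space (hx : x ∈ C.space) : C.transformation x ∈ C.space := by
  obtain ⟨n, m, hm, hxm⟩ := exists_mem_level_add_one_lt hx
  exact level_subset_space hm (transformation_mem_level hm hxm)

/-- Two points of the space can be placed in non-top levels of a common column, where distinct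
levels go to distinct levels by translations. -/
lemma transformation_injective (C : RankOneConstruction) :
    Function.Injective C.transformation := by
  intro x y hxy
  by_cases hx : x ∈ C.space <;> by_cases hy : y ∈ C.space
  · obtain ⟨n, m, hm, hxm⟩ := exists_mem_level_add_one_lt hx
    obtain ⟨n', m', hm', hym⟩ := exists_mem_level_add_one_lt hy
    obtain ⟨a, ha, hxa, -⟩ := exists_mem_level_add_one_lt_of_le (le_max_left n n') hm hxm
    obtain ⟨b, hb, hyb, -⟩ := exists_mem_level_add_one_lt_of_le (le_max_right n n') hm' hym
    have h1 := transformation_mem_level ha hxa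
    have h2 := transformation_mem_level hb hyb
    rw [hxy] at h1
    obtain rfl : a = b := by simpa using eq_of_mem_level ha hb h1 h2
    rw [transformation_of_mem ha hxa, transformation_of_mem hb hyb] at hxy
    exact add_right_cancel hxy
  · rw [transformation_of_notMem_space hy] at hxy
    exact absurd (hxy ▸ transformation_mem_space hx) hy
  · rw [transformation_of_notMem_space hx] at hxy
    exact absurd (hxy ▸ transformation_mem_space hy) hx
  · rwa [transformation_of_notMem_space hx, transformation_of_notMem_space hy] at hxy

/-- The leftmost subcolumn keeps its left end points. The bases thus shrink to `0`, the only point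
of the space with no preimage there. -/
lemma left_base (C : RankOneConstruction) (n : ℕ) : C.left n 0 = 0 := by
  induction n with
  | zero => exact C.left_zero
  | succ n ih =>
    have h := C.left_succ n 0 0 (by have := C.two_le_r n; omega) (C.height_pos n)
    simpa [rankOneOffset, ih] using h

lemma disjoint_level {m' : ℕ} (hm : m < C.height n) (hm' : m' < C.height n) (h : m ≠ m') :
    Disjoint (C.level n m) (C.level n m') :=
  C.disjoint_levels n m m' hm hm' h

lemma volume_preimage_transformation_inter_level (hm : m + 1 < C.height n) (E : Set ℝ) :
    volume (C.transformation ⁻¹' E ∩ C.level n m) = volume (E ∩ C.level n (m + 1)) := by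
  rw [← measure_preimage_add_right volume (C.left n (m + 1) - C.left n m) (E ∩ C.level n (m + 1))]
  congr 1
  ext x
  simp only [Set.mem_inter_iff, Set.mem_preimage, add_mem_level_iff rfl]
  exact and_congr_left fun hx => by rw [transformation_of_mem hm hx]

/-- The unions of the non-top levels and of the non-bottom levels both increase to the space, the
latter up to a null set. At each stage the two sides agree level by level. -/
lemma measurePreserving_transformation (C : RankOneConstruction) :
    MeasurePreserving C.transformation C.measure C.measure := by
  refine ⟨C.measurable_transformation, Measure.ext fun E hE => ?_⟩
  have hE' := C.measurable_transformation hE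
  rw [Measure.map_apply C.measurable_transformation hE, RankOneConstruction.measure,
    Measure.restrict_apply hE', Measure.restrict_apply hE]
  set G : ℕ → Set ℝ := fun n => ⋃ m ∈ Finset.range (C.height n - 1), C.level n m with hG
  set H : ℕ → Set ℝ := fun n => ⋃ m ∈ Finset.range (C.height n - 1), C.level n (m + 1) with hH
  have mem_G : ∀ n x, x ∈ G n ↔ ∃ m, m + 1 < C.height n ∧ x ∈ C.level n m := fun n x => by
    simp [hG, Nat.lt_sub_iff_add_lt]
  have mem_H : ∀ n x, x ∈ H n ↔ ∃ m, m + 1 < C.height n ∧ x ∈ C.level n (m + 1) := fun n x => by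
    simp [hH, Nat.lt_sub_iff_add_lt]
  have G_mono : Monotone G := fun i j hij x hx => by
    obtain ⟨m, hm, hx⟩ := (mem_G i x).1 hx
    obtain ⟨a, ha, hxa, -⟩ := exists_mem_level_add_one_lt_of_le hij hm hx
    exact (mem_G j x).2 ⟨a, ha, hxa⟩
  have H_mono : Monotone H := fun i j hij x hx => by
    obtain ⟨m, hm, hx⟩ := (mem_H i x).1 hx
    -- Compatibility is known for non-top levels, so it is applied to the point one level below.
    have hx' : x - (C.left i (m + 1) - C.left i m) ∈ C.level i m := by
      rwa [← add_mem_level_iff rfl, sub_add_cancel]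
    obtain ⟨a, ha, hxa, h⟩ := exists_mem_level_add_one_lt_of_le hij hm hx'
    refine (mem_H j x).2 ⟨a, ha, ?_⟩
    rwa [← add_mem_level_iff h.symm, sub_add_cancel] at hxa
  have iUnion_G : ⋃ n, G n = C.space := by
    ext x
    simp only [Set.mem_iUnion, mem_G]
    exact ⟨fun ⟨n, m, hm, hx⟩ => level_subset_space (Nat.lt_of_succ_lt hm) hx,
      exists_mem_level_add_one_lt⟩
  -- A point of the space in no non-bottom level lies in the base of every late column, hence is
  -- `0`.
  have iUnion_H : (⋃ n, H n : Set ℝ) =ᵐ[volume] C.space := by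
    refine (LE.le.eventuallyLE fun x hx => ?_).antisymm
      ((measure_eq_zero_iff_ae_notMem.1 (measure_singleton (0 : ℝ))).mono fun x hx0 hx => ?_)
    · simp only [Set.mem_iUnion, mem_H] at hx
      obtain ⟨n, m, hm, hx⟩ := hx
      exact level_subset_space hm hx
    · by_contra hxH
      replace hxH : ∀ n m, m + 1 < C.height n → x ∉ C.level n (m + 1) := fun n m hm h =>
        hxH (Set.mem_iUnion.2 ⟨n, (mem_H n x).2 ⟨m, hm, h⟩⟩)
      obtain ⟨N, m, hm, hxm⟩ := mem_space.1 hx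
      have hbase : ∀ n, N ≤ n → 0 ≤ x ∧ x < rankOneWidth C.r n := fun n hn => by
        obtain ⟨a, ha, hxa⟩ := exists_mem_level hn hm hxm
        obtain rfl | ⟨a, rfl⟩ : a = 0 ∨ ∃ b, a = b + 1 := by cases a <;> simp
        · simpa [mem_level, left_base] using hxa
        · exact absurd hxa (hxH n a ha)
      have hpos : 0 < x := lt_of_le_of_ne (hbase N le_rfl).1 fun h => hx0 h.symm
      obtain ⟨n, hn, hNn⟩ := ((C.tendsto_rankOneWidth.eventually_lt_const hpos).and
        (Filter.eventually_ge_atTop N)).exists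
      exact absurd hn (hbase n hNn).2.not_gt
  have hGH : ∀ n, volume (C.transformation ⁻¹' E ∩ G n) = volume (E ∩ H n) := fun n => by
    rw [hG, hH, Set.inter_iUnion₂, Set.inter_iUnion₂, measure_biUnion_finset,
      measure_biUnion_finset]
    · refine Finset.sum_congr rfl fun m hm => volume_preimage_transformation_inter_level ?_ E
      rw [Finset.mem_range] at hm
      omega
    · intro m hm m' hm' hne
      simp only [Finset.coe_range, Set.mem_Iio] at hm hm'
      exact (disjoint_level (by omega) (by omega) (by simpa using hne)).mono
        Set.inter_subset_right Set.inter_subset_right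
    · exact fun _ _ => hE.inter (measurableSet_level _ _)
    · intro m hm m' hm' hne
      simp only [Finset.coe_range, Set.mem_Iio] at hm hm'
      exact (disjoint_level (by omega) (by omega) hne).mono
        Set.inter_subset_right Set.inter_subset_right
    · exact fun _ _ => hE'.inter (measurableSet_level _ _)
  calc volume (C.transformation ⁻¹' E ∩ C.space)
      = ⨆ n, volume (C.transformation ⁻¹' E ∩ G n) := by
        rw [← iUnion_G, Set.inter_iUnion]
        exact Monotone.measure_iUnion fun i j h => Set.inter_subset_inter_right _ (G_mono h)
    _ = ⨆ n, volume (E ∩ H n) := by simp_rw [hGH]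
    _ = volume (E ∩ C.space) := by
        rw [← Monotone.measure_iUnion fun i j h => Set.inter_subset_inter_right _ (H_mono h),
          ← Set.inter_iUnion]
        exact measure_congr ((Filter.EventuallyEq.refl _ E).inter iUnion_H)

end RankOneConstruction

/-! ### Descendants -/

namespace RankOneConstruction

variable {C : RankOneConstruction} {i j n m a b k p q : ℕ} {x : ℝ}

lemma mem_descendants :
    a ∈ C.descendants i m j ↔ a < C.height j ∧ C.level j a ⊆ C.level i m := by
  simp [descendants]

lemma level_eq_biUnion_descendants (hij : i ≤ j) (hm : m < C.height i) :
    C.level i m = ⋃ a ∈ C.descendants i m j, C.level j a := by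
  ext x
  simp only [Set.mem_iUnion, mem_descendants, exists_prop]
  constructor
  · intro hx
    obtain ⟨a, ha, hxa⟩ := exists_mem_level hij hm hx
    exact ⟨a, ⟨ha, level_subset_of_mem hij hm ha hx hxa⟩, hxa⟩
  · rintro ⟨a, ⟨-, h⟩, hx⟩
    exact h hx

lemma volume_real_level (C : RankOneConstruction) (n m : ℕ) :
    volume.real (C.level n m) = rankOneWidth C.r n := by
  rw [level, Real.volume_real_Ico_of_le (by linarith [C.rankOneWidth_pos n])]
  ring

lemma volume_level_ne_top (C : RankOneConstruction) (n m : ℕ) : volume (C.level n m) ≠ ⊤ :=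
  measure_Ico_lt_top.ne

lemma card_descendants (hij : i ≤ j) (hm : m < C.height i) :
    (C.descendants i m j).card * rankOneWidth C.r j = rankOneWidth C.r i := by
  rw [← volume_real_level C i m, level_eq_biUnion_descendants hij hm,
    measureReal_biUnion_finset (h := fun a _ => C.volume_level_ne_top j a)]
  · simp [volume_real_level]
  · exact fun a ha a' ha' hne =>
      disjoint_level (mem_descendants.1 ha).1 (mem_descendants.1 ha').1 hne
  · exact fun _ _ => measurableSet_level _ _

lemma add_one_mem_descendants (hij : i ≤ j) (hm : m + 1 < C.height i)
    (ha : a ∈ C.descendants i m j) : a + 1 ∈ C.descendants i (m + 1) j := by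
  rw [mem_descendants] at ha ⊢
  have hx := C.left_mem_level j a
  obtain ⟨h1, h2⟩ := left_add_one_sub_left hij hm ha.1 (ha.2 hx) hx
  refine ⟨h1, level_subset_of_mem hij hm h1 ?_ (C.left_mem_level j (a + 1))⟩
  rw [show C.left j (a + 1) = C.left j a + (C.left i (m + 1) - C.left i m) by linarith,
    add_mem_level_iff rfl]
  exact ha.2 hx

lemma add_mem_descendants (hij : i ≤ j) (hb : b < C.height i)
    (ha : a ∈ C.descendants i 0 j) : a + b ∈ C.descendants i b j := by
  induction b with
  | zero => exact ha
  | succ b ih => exact add_one_mem_descendants hij hb (ih (Nat.lt_of_succ_lt hb))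

/-- Climbing `b` levels gives one inclusion; equality follows because levels of equal width have
equally many descendants. -/
lemma map_add_descendants (hij : i ≤ j) (hb : b < C.height i) :
    (C.descendants i 0 j).map (addRightEmbedding b) = C.descendants i b j := by
  refine Finset.eq_of_subset_of_card_le (fun a ha => ?_) ?_
  · obtain ⟨c, hc, rfl⟩ := Finset.mem_map.1 ha
    exact add_mem_descendants hij hb hc
  · rw [Finset.card_map]
    have h := (card_descendants hij hb).trans (card_descendants hij (C.height_pos i)).symm
    exact_mod_cast (mul_right_cancel₀ (C.rankOneWidth_pos j).ne' h).le

/-! ### Mass of an invariant set in products of levels -/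

variable (C) in
/-- The mass of `A` in the product of the levels at heights `p` and `q` of the column `C n`. -/
noncomputable def mass (A : Set (ℝ × ℝ)) (n p q : ℕ) : ℝ :=
  volume.real (A ∩ C.level n p ×ˢ C.level n q)

variable {A : Set (ℝ × ℝ)}

lemma measurableSet_level_prod (n p q : ℕ) : MeasurableSet (C.level n p ×ˢ C.level n q) :=
  (measurableSet_level n p).prod (measurableSet_level n q)

lemma volume_level_prod_ne_top (C : RankOneConstruction) (n p q : ℕ) :
    volume (C.level n p ×ˢ C.level n q) ≠ ⊤ := by
  rw [Measure.volume_eq_prod, Measure.prod_prod]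
  exact ENNReal.mul_ne_top (C.volume_level_ne_top n p) (C.volume_level_ne_top n q)

lemma volume_inter_level_prod_ne_top (A : Set (ℝ × ℝ)) (n p q : ℕ) :
    volume (A ∩ C.level n p ×ˢ C.level n q) ≠ ⊤ :=
  measure_ne_top_of_subset Set.inter_subset_right (C.volume_level_prod_ne_top n p q)

lemma volume_real_level_prod (C : RankOneConstruction) (n p q : ℕ) :
    volume.real (C.level n p ×ˢ C.level n q) = rankOneWidth C.r n ^ 2 := by
  rw [Measure.volume_eq_prod, measureReal_prod_prod, volume_real_level, volume_real_level, sq]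

lemma mass_nonneg (A : Set (ℝ × ℝ)) (n p q : ℕ) : 0 ≤ C.mass A n p q := measureReal_nonneg

lemma mass_le (A : Set (ℝ × ℝ)) (n p q : ℕ) : C.mass A n p q ≤ rankOneWidth C.r n ^ 2 := by
  rw [← volume_real_level_prod C n p q]
  exact measureReal_mono Set.inter_subset_right (C.volume_level_prod_ne_top n p q)

lemma mass_add_mass_compl (hA : MeasurableSet A) (n p q : ℕ) :
    C.mass A n p q + C.mass Aᶜ n p q = rankOneWidth C.r n ^ 2 := by
  rw [← volume_real_level_prod C n p q, mass, mass, Set.inter_comm, Set.inter_comm Aᶜ,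
    ← Set.sdiff_eq]
  exact measureReal_inter_add_sdiff hA (C.volume_level_prod_ne_top n p q)

lemma mass_preimage_swap (hA : MeasurableSet A) (n p q : ℕ) :
    C.mass (Prod.swap ⁻¹' A) n p q = C.mass A n q p := by
  have h := (Measure.measurePreserving_swap (μ := (volume : Measure ℝ))
    (ν := (volume : Measure ℝ))).measureReal_preimage
    (hA.inter (measurableSet_level_prod (C := C) n q p)).nullMeasurableSet
  rw [Set.preimage_inter, Set.preimage_swap_prod] at h
  exact h

lemma mass_add_one (hA : Prod.map C.transformation C.transformation ⁻¹' A = A)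
    (hp : p + 1 < C.height n) (hq : q + 1 < C.height n) :
    C.mass A n (p + 1) (q + 1) = C.mass A n p q := by
  rw [mass, mass, measureReal_def, measureReal_def, ← measure_preimage_add_right volume
    (C.left n (p + 1) - C.left n p, C.left n (q + 1) - C.left n q)
    (A ∩ C.level n (p + 1) ×ˢ C.level n (q + 1))]
  congr 2
  ext ⟨x, y⟩
  simp only [Set.mem_inter_iff, Set.mem_preimage, Prod.mk_add_mk, Set.mem_prod,
    add_mem_level_iff rfl]
  refine and_congr_left fun ⟨hx, hy⟩ => ?_
  conv_rhs => rw [← hA]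
  rw [Set.mem_preimage, Prod.map_apply, transformation_of_mem hp hx, transformation_of_mem hq hy]

lemma mass_add (hA : Prod.map C.transformation C.transformation ⁻¹' A = A)
    (hp : p + k < C.height n) (hq : q + k < C.height n) :
    C.mass A n (p + k) (q + k) = C.mass A n p q := by
  induction k with
  | zero => rfl
  | succ k ih =>
    exact (mass_add_one hA hp hq).trans <| ih (Nat.lt_of_succ_lt hp) (Nat.lt_of_succ_lt hq)

lemma mass_eq_of_sub_eq_sub (hA : Prod.map C.transformation C.transformation ⁻¹' A = A)
    {p' q' : ℕ} (hp : p < C.height n) (hq : q < C.height n) (hp' : p' < C.height n)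
    (hq' : q' < C.height n) (h : (p : ℤ) - p' = q - q') : C.mass A n p q = C.mass A n p' q' := by
  rcases le_total p' p with hle | hle
  · obtain ⟨k, rfl⟩ := Nat.exists_eq_add_of_le hle
    obtain rfl : q = q' + k := by omega
    exact mass_add hA hp hq
  · obtain ⟨k, rfl⟩ := Nat.exists_eq_add_of_le hle
    obtain rfl : q' = q + k := by omega
    exact (mass_add hA hp' hq').symm

lemma mass_eq_sum (hA : MeasurableSet A) (hij : i ≤ j) (hp : p < C.height i)
    (hq : q < C.height i) :
    C.mass A i p q =
      ∑ c ∈ C.descendants i p j ×ˢ C.descendants i q j, C.mass A j c.1 c.2 := by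
  have h : A ∩ C.level i p ×ˢ C.level i q =
      ⋃ c ∈ C.descendants i p j ×ˢ C.descendants i q j, A ∩ C.level j c.1 ×ˢ C.level j c.2 := by
    rw [level_eq_biUnion_descendants hij hp, level_eq_biUnion_descendants hij hq]
    ext ⟨x, y⟩
    simp only [Set.mem_inter_iff, Set.mem_prod, Set.mem_iUnion, Finset.mem_product, exists_prop,
      Prod.exists]
    constructor
    · rintro ⟨h, ⟨c, hc, hx⟩, d, hd, hy⟩
      exact ⟨c, d, ⟨hc, hd⟩, h, hx, hy⟩
    · rintro ⟨c, d, ⟨hc, hd⟩, h, hx, hy⟩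
      exact ⟨h, ⟨c, hc, hx⟩, d, hd, hy⟩
  rw [mass, h, measureReal_biUnion_finset
    (h := fun _ _ => volume_inter_level_prod_ne_top _ _ _ _)]
  · rfl
  · rintro ⟨c, d⟩ hcd ⟨c', d'⟩ hcd' hne
    simp only [Finset.coe_product, Set.mem_prod, Finset.mem_coe, mem_descendants] at hcd hcd'
    refine Disjoint.mono Set.inter_subset_right Set.inter_subset_right (Set.disjoint_prod.2 ?_)
    by_cases hc : c = c'
    · exact .inr (disjoint_level hcd.2.1 hcd'.2.1 fun hd => hne (Prod.ext hc hd))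
    · exact .inl (disjoint_level hcd.1.1 hcd'.1.1 hc)
  · exact fun _ _ => hA.inter (measurableSet_level_prod _ _ _)

/-- Pairs in `F` are matched injectively with pieces of base times base of the same mass; the
remaining pairs are bounded by their total area. -/
lemma mass_le_of_hasUniquePairs {ε : ℝ} (hA : MeasurableSet A)
    (hinv : Prod.map C.transformation C.transformation ⁻¹' A = A) (hij : i ≤ j)
    (hb : b < C.height i) (h : C.HasUniquePairs ε i b j) :
    C.mass A i b 0 ≤ C.mass A i 0 0 + ε * rankOneWidth C.r i ^ 2 := by
  obtain ⟨F, hF, hcard, φ, hφ, hφF⟩ := h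
  have h0 := C.height_pos i
  set D := C.descendants i 0 j with hD
  have hsum : C.mass A i b 0 = ∑ c ∈ D ×ˢ D, C.mass A j (c.1 + b) c.2 := by
    rw [mass_eq_sum hA hij hb h0, ← map_add_descendants hij hb, Finset.sum_product,
      Finset.sum_map, Finset.sum_product]
    rfl
  have hle : ∑ c ∈ F, C.mass A j (c.1 + b) c.2 ≤ C.mass A i 0 0 := by
    calc ∑ c ∈ F, C.mass A j (c.1 + b) c.2
        = ∑ c ∈ F, C.mass A j (φ c).1 (φ c).2 := by
          refine Finset.sum_congr rfl fun c hc => ?_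
          have hc' := Finset.mem_product.1 (hF hc)
          obtain ⟨h1, h2⟩ := hφF c hc
          rw [Finset.mem_product] at h1
          -- The defining relation reads `(a + b) - d = a' - d'`: same diagonal.
          refine mass_eq_of_sub_eq_sub hinv (mem_descendants.1 (add_mem_descendants hij hb hc'.1)).1
            (mem_descendants.1 hc'.2).1 (mem_descendants.1 h1.1).1 (mem_descendants.1 h1.2).1 ?_
          push_cast
          linarith
      _ = ∑ c ∈ F.image φ, C.mass A j c.1 c.2 := 
          (Finset.sum_image (f := fun c : ℕ × ℕ => C.mass A j c.1 c.2) hφ).symm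
      _ ≤ ∑ c ∈ D ×ˢ D, C.mass A j c.1 c.2 := by
          refine Finset.sum_le_sum_of_subset_of_nonneg ?_ fun _ _ _ => mass_nonneg _ _ _ _
          exact Finset.image_subset_iff.2 fun c hc => (hφF c hc).1
      _ = C.mass A i 0 0 := (mass_eq_sum hA hij h0 h0).symm
  have hrest : ∑ c ∈ (D ×ˢ D) \ F, C.mass A j (c.1 + b) c.2 ≤ ε * rankOneWidth C.r i ^ 2 := by
    calc ∑ c ∈ (D ×ˢ D) \ F, C.mass A j (c.1 + b) c.2
        ≤ ((D ×ˢ D) \ F).card • rankOneWidth C.r j ^ 2 :=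
          Finset.sum_le_card_nsmul _ _ _ fun _ _ => mass_le _ _ _ _
      _ = ((D.card : ℝ) ^ 2 - F.card) * rankOneWidth C.r j ^ 2 := by
          rw [nsmul_eq_mul, Finset.cast_card_sdiff hF, Finset.card_product]
          push_cast
          ring
      _ ≤ (ε * (D.card : ℝ) ^ 2) * rankOneWidth C.r j ^ 2 := by
          refine mul_le_mul_of_nonneg_right ?_ (sq_nonneg _)
          linarith
      _ = ε * rankOneWidth C.r i ^ 2 := by
          rw [← card_descendants hij h0]
          ring
  rw [hsum, ← Finset.sum_sdiff hF]
  linarith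

variable (C) in
/-- For every column `C i` and every gap `b` between non-top levels, almost all pairs of descendants
of the base of `C i` in some later column have uniquely corresponding pairs. -/
def HasAllUniquePairs : Prop :=
  ∀ ε : ℝ, 0 < ε → ∀ i b : ℕ, (b : ℤ) < (C.height i : ℤ) - 1 →
    ∃ j : ℕ, i < j ∧ C.HasUniquePairs ε i b j

lemma mass_base_right (hC : C.HasAllUniquePairs) (hA : MeasurableSet A)
    (hinv : Prod.map C.transformation C.transformation ⁻¹' A = A) (hb : b + 1 < C.height i) :
    C.mass A i b 0 = C.mass A i 0 0 := by
  have key : ∀ B : Set (ℝ × ℝ), MeasurableSet B →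
      Prod.map C.transformation C.transformation ⁻¹' B = B →
      C.mass B i b 0 ≤ C.mass B i 0 0 := fun B hB hBinv => by
    have hw := pow_pos (C.rankOneWidth_pos i) 2
    refine le_of_forall_pos_le_add fun δ hδ => ?_
    obtain ⟨j, hij, hj⟩ := hC (δ / rankOneWidth C.r i ^ 2) (div_pos hδ hw) i b (by omega)
    have := mass_le_of_hasUniquePairs hB hBinv hij.le (Nat.lt_of_succ_lt hb) hj
    rwa [div_mul_cancel₀ _ hw.ne'] at this
  have h1 := key A hA hinv
  -- The masses of `A` and `Aᶜ` have a fixed sum, so the bound for `Aᶜ` is the reverse bound for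
  -- `A`.
  have h2 := key Aᶜ hA.compl (by rw [Set.preimage_compl, hinv])
  have h3 := mass_add_mass_compl (C := C) hA i b 0
  have h4 := mass_add_mass_compl (C := C) hA i 0 0
  linarith

lemma mass_base_left (hC : C.HasAllUniquePairs) (hA : MeasurableSet A)
    (hinv : Prod.map C.transformation C.transformation ⁻¹' A = A) (hb : b + 1 < C.height i) :
    C.mass A i 0 b = C.mass A i 0 0 := by
  have hinv' : Prod.map C.transformation C.transformation ⁻¹' (Prod.swap ⁻¹' A) =
      Prod.swap ⁻¹' A := by
    conv_rhs => rw [← hinv]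
    rfl
  have h := mass_base_right hC (measurable_swap hA) hinv' hb
  rwa [mass_preimage_swap hA, mass_preimage_swap hA] at h

/-- An invariant set has the same mass in all products of two non-top levels of a column. -/
lemma mass_eq_mass_base (hC : C.HasAllUniquePairs) (hA : MeasurableSet A)
    (hinv : Prod.map C.transformation C.transformation ⁻¹' A = A) (hp : p + 1 < C.height i)
    (hq : q + 1 < C.height i) : C.mass A i p q = C.mass A i 0 0 := by
  rcases le_total q p with h | h
  · obtain ⟨b, rfl⟩ := Nat.exists_eq_add_of_le' h
    rw [← mass_base_right hC hA hinv (show b + 1 < C.height i by omega)]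
    have := mass_add (p := b) (q := 0) (k := q) hinv (Nat.lt_of_succ_lt hp) (by omega)
    rwa [zero_add] at this
  · obtain ⟨b, rfl⟩ := Nat.exists_eq_add_of_le' h
    rw [← mass_base_left hC hA hinv (show b + 1 < C.height i by omega)]
    have := mass_add (p := 0) (q := b) (k := p) hinv (by omega) (Nat.lt_of_succ_lt hq)
    rwa [zero_add] at this

lemma exists_mass_eq_mul (hC : C.HasAllUniquePairs) (hA : MeasurableSet A)
    (hinv : Prod.map C.transformation C.transformation ⁻¹' A = A) :
    ∃ ρ : ℝ, 0 ≤ ρ ∧ ∀ n p q, p + 1 < C.height n → q + 1 < C.height n →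
      C.mass A n p q = ρ * rankOneWidth C.r n ^ 2 := by
  -- The density is read off in `C 1`, since the only level of `C 0` is its top.
  refine ⟨C.mass A 1 0 0 / rankOneWidth C.r 1 ^ 2,
    div_nonneg (mass_nonneg _ _ _ _) (sq_nonneg _), fun n p q hp hq => ?_⟩
  have hn : 1 ≤ n := by
    rcases Nat.eq_zero_or_pos n with rfl | h
    · rw [height_zero] at hp
      omega
    · exact h
  have h2 := C.two_le_height le_rfl
  have hw := C.rankOneWidth_pos 1
  have h0 := C.height_pos 1
  -- The base of `C 1` is not its top level, so its descendants are never top levels.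
  have hD : ∀ a ∈ C.descendants 1 0 n, a + 1 < C.height n := fun a ha =>
    (mem_descendants.1 (add_one_mem_descendants hn h2 ha)).1
  have hsum : C.mass A 1 0 0 = ((C.descendants 1 0 n).card : ℝ) ^ 2 * C.mass A n 0 0 := by
    rw [mass_eq_sum hA hn h0 h0, Finset.sum_congr rfl (g := fun _ => C.mass A n 0 0),
      Finset.sum_const, Finset.card_product, nsmul_eq_mul]
    · push_cast
      ring
    · intro c hc
      rw [Finset.mem_product] at hc
      exact mass_eq_mass_base hC hA hinv (hD _ hc.1) (hD _ hc.2)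
  have hcard := card_descendants hn h0
  rw [mass_eq_mass_base hC hA hinv hp hq, div_mul_eq_mul_div, eq_div_iff (pow_pos hw 2).ne', hsum,
    ← hcard]
  ring

end RankOneConstruction

/-! ### From equal densities to ergodicity -/

namespace RankOneConstruction

variable {C : RankOneConstruction} {A : Set (ℝ × ℝ)}

variable (C) in
/-- The products of two non-top levels of a column. -/
def levelProds : Set (Set (ℝ × ℝ)) :=
  {R | ∃ n p q, p + 1 < C.height n ∧ q + 1 < C.height n ∧ R = C.level n p ×ˢ C.level n q}

variable (C) in
/-- The products of two non-top levels of a column and the measurable sets outside the space. -/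
def piSystem : Set (Set (ℝ × ℝ)) :=
  C.levelProds ∪ {s | MeasurableSet s ∧ Disjoint s (C.space ×ˢ C.space)}

lemma countable_levelProds (C : RankOneConstruction) : C.levelProds.Countable := by
  refine (Set.countable_range fun t : ℕ × ℕ × ℕ => C.level t.1 t.2.1 ×ˢ C.level t.1 t.2.2).mono ?_
  rintro _ ⟨n, p, q, -, -, rfl⟩
  exact ⟨(n, p, q), rfl⟩

lemma measurableSet_of_mem_levelProds {R : Set (ℝ × ℝ)} (hR : R ∈ C.levelProds) :
    MeasurableSet R := by
  obtain ⟨n, p, q, -, -, rfl⟩ := hR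
  exact measurableSet_level_prod n p q

lemma subset_space_prod_of_mem_levelProds {R : Set (ℝ × ℝ)} (hR : R ∈ C.levelProds) :
    R ⊆ C.space ×ˢ C.space := by
  obtain ⟨n, p, q, hp, hq, rfl⟩ := hR
  exact Set.prod_mono (level_subset_space (Nat.lt_of_succ_lt hp))
    (level_subset_space (Nat.lt_of_succ_lt hq))

/-- The products of two non-top levels form a topological basis of the square of the space. -/
lemma exists_mem_levelProds_subset {U : Set (ℝ × ℝ)} (hU : IsOpen U) {z : ℝ × ℝ} (hz : z ∈ U)
    (hzs : z ∈ C.space ×ˢ C.space) : ∃ R ∈ C.levelProds, z ∈ R ∧ R ⊆ U := by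
  obtain ⟨δ, hδ, hball⟩ := Metric.isOpen_iff.1 hU z hz
  obtain ⟨n₁, m₁, hm₁, hx⟩ := exists_mem_level_add_one_lt hzs.1
  obtain ⟨n₂, m₂, hm₂, hy⟩ := exists_mem_level_add_one_lt hzs.2
  obtain ⟨n, hn, hn₁, hn₂⟩ := ((C.tendsto_rankOneWidth.eventually_lt_const hδ).and
    ((Filter.eventually_ge_atTop n₁).and (Filter.eventually_ge_atTop n₂))).exists
  obtain ⟨p, hp, hxp, -⟩ := exists_mem_level_add_one_lt_of_le hn₁ hm₁ hx
  obtain ⟨q, hq, hyq, -⟩ := exists_mem_level_add_one_lt_of_le hn₂ hm₂ hy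
  refine ⟨_, ⟨n, p, q, hp, hq, rfl⟩, ⟨hxp, hyq⟩, fun w hw => hball ?_⟩
  obtain ⟨h1, h2⟩ := hw
  rw [mem_level] at hxp hyq h1 h2
  rw [Metric.mem_ball, Prod.dist_eq, max_lt_iff, Real.dist_eq, Real.dist_eq, abs_lt, abs_lt]
  refine ⟨⟨?_, ?_⟩, ?_, ?_⟩ <;> linarith

/-- An open set is its part off the square of the space together with countably many products of
levels. -/
lemma generateFrom_piSystem (C : RankOneConstruction) :
    (inferInstance : MeasurableSpace (ℝ × ℝ)) = MeasurableSpace.generateFrom C.piSystem := by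
  refine le_antisymm ?_ (MeasurableSpace.generateFrom_le ?_)
  · rw [BorelSpace.measurable_eq (α := ℝ × ℝ)]
    refine MeasurableSpace.generateFrom_le fun U hU => ?_
    have hUo : IsOpen U := hU
    have h : U = U \ (C.space ×ˢ C.space) ∪ ⋃₀ {R ∈ C.levelProds | R ⊆ U} := by
      refine Set.Subset.antisymm (fun z hz => ?_)
        (Set.union_subset Set.sdiff_subset (Set.sUnion_subset fun R hR => hR.2))
      by_cases hzs : z ∈ C.space ×ˢ C.space
      · obtain ⟨R, hR, hzR, hRU⟩ := exists_mem_levelProds_subset hUo hz hzs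
        exact .inr ⟨R, ⟨hR, hRU⟩, hzR⟩
      · exact .inl ⟨hz, hzs⟩
    rw [h]
    refine MeasurableSet.union (MeasurableSpace.measurableSet_generateFrom (.inr ⟨?_, ?_⟩))
      (MeasurableSet.sUnion (C.countable_levelProds.mono fun R hR => hR.1) fun R hR =>
        MeasurableSpace.measurableSet_generateFrom (.inl hR.1))
    · exact hUo.measurableSet.diff (C.measurableSet_space.prod C.measurableSet_space)
    · exact Set.disjoint_sdiff_left
  · rintro s (hs | hs)
    · exact measurableSet_of_mem_levelProds hs
    · exact hs.1

lemma inter_mem_levelProds {n n' p p' q q' : ℕ} (hnn' : n ≤ n') (hp : p + 1 < C.height n)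
    (hq : q + 1 < C.height n) (hp' : p' + 1 < C.height n') (hq' : q' + 1 < C.height n')
    (h : (C.level n p ×ˢ C.level n q ∩ C.level n' p' ×ˢ C.level n' q').Nonempty) :
    C.level n p ×ˢ C.level n q ∩ C.level n' p' ×ˢ C.level n' q' ∈ C.levelProds := by
  obtain ⟨z, ⟨h1, h2⟩, h3, h4⟩ := h
  rw [Set.inter_eq_right.2 (Set.prod_mono
    (level_subset_of_mem hnn' (Nat.lt_of_succ_lt hp) (Nat.lt_of_succ_lt hp') h1 h3)
    (level_subset_of_mem hnn' (Nat.lt_of_succ_lt hq) (Nat.lt_of_succ_lt hq') h2 h4))]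
  exact ⟨n', p', q', hp', hq', rfl⟩

lemma isPiSystem_piSystem (C : RankOneConstruction) : IsPiSystem C.piSystem := by
  rintro s hs t ht hst
  have hmeas : ∀ u ∈ C.piSystem, MeasurableSet u := by
    rintro u (hu | hu)
    exacts [measurableSet_of_mem_levelProds hu, hu.1]
  rcases hs with hs | hs
  · rcases ht with ht | ht
    · left
      obtain ⟨n, p, q, hp, hq, rfl⟩ := hs
      obtain ⟨n', p', q', hp', hq', rfl⟩ := ht
      rcases le_total n n' with h | h
      · exact inter_mem_levelProds h hp hq hp' hq' hst
      · rw [Set.inter_comm] at hst ⊢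
        exact inter_mem_levelProds h hp' hq' hp hq hst
    · exact .inr ⟨(hmeas s (.inl hs)).inter ht.1, ht.2.mono_left Set.inter_subset_right⟩
  · exact .inr ⟨hs.1.inter (hmeas t ht), hs.2.mono_left Set.inter_subset_left⟩

lemma measure_prod_measure (C : RankOneConstruction) :
    C.measure.prod C.measure = volume.restrict (C.space ×ˢ C.space) := by
  rw [RankOneConstruction.measure, Measure.prod_restrict, Measure.volume_eq_prod]

lemma measure_prod_apply_of_disjoint {s : Set (ℝ × ℝ)} (hs : Disjoint s (C.space ×ˢ C.space)) :
    C.measure.prod C.measure s = 0 := by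
  rw [measure_prod_measure, Measure.restrict_apply' (C.measurableSet_space.prod
    C.measurableSet_space), hs.inter_eq, measure_empty]

lemma measure_prod_apply_of_subset {s : Set (ℝ × ℝ)} (hs : s ⊆ C.space ×ˢ C.space) :
    C.measure.prod C.measure s = volume s := by
  rw [measure_prod_measure, Measure.restrict_apply' (C.measurableSet_space.prod
    C.measurableSet_space), Set.inter_eq_left.2 hs]

/-- The product measure restricted to an invariant set is a multiple of the product measure. -/
lemma exists_restrict_eq_smul (hC : C.HasAllUniquePairs) (hA : MeasurableSet A)
    (hinv : Prod.map C.transformation C.transformation ⁻¹' A = A) :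
    ∃ ρ : ENNReal, (C.measure.prod C.measure).restrict A = ρ • C.measure.prod C.measure := by
  obtain ⟨ρ, hρ, hmass⟩ := exists_mass_eq_mul hC hA hinv
  -- The measures live on the square of the space but are defined on the whole plane; its null
  -- complement completes the countable cover by sets of finite measure.
  refine ⟨ENNReal.ofReal ρ, Measure.ext_of_generateFrom_of_cover_subset
    (T := insert (C.space ×ˢ C.space)ᶜ C.levelProds) C.generateFrom_piSystem C.isPiSystem_piSystem
    ?_ (C.countable_levelProds.insert _) ?_ ?_ ?_⟩
  · rintro s (rfl | hs)
    · exact .inr ⟨(C.measurableSet_space.prod C.measurableSet_space).compl,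
        disjoint_compl_left⟩
    · exact .inl hs
  · refine Set.eq_univ_of_forall fun z => ?_
    by_cases hz : z ∈ C.space ×ˢ C.space
    · obtain ⟨R, hR, hzR, -⟩ := exists_mem_levelProds_subset isOpen_univ (Set.mem_univ z) hz
      exact ⟨R, .inr hR, hzR⟩
    · exact ⟨_, .inl rfl, hz⟩
  · rintro s (rfl | hs)
    · refine ((Measure.restrict_le_self _).trans ?_).trans_lt ENNReal.zero_lt_top |>.ne
      exact (measure_prod_apply_of_disjoint disjoint_compl_left).le
    · refine ((Measure.restrict_le_self _).trans_lt ?_).ne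
      rw [measure_prod_apply_of_subset (subset_space_prod_of_mem_levelProds hs)]
      obtain ⟨n, p, q, -, -, rfl⟩ := hs
      exact (C.volume_level_prod_ne_top n p q).lt_top
  · rintro s (hs | hs)
    · have hsub := subset_space_prod_of_mem_levelProds hs
      rw [Measure.restrict_apply (measurableSet_of_mem_levelProds hs),
        measure_prod_apply_of_subset (Set.inter_subset_left.trans hsub), Measure.smul_apply,
        measure_prod_apply_of_subset hsub, smul_eq_mul, Set.inter_comm]
      obtain ⟨n, p, q, hp, hq, rfl⟩ := hs
      have h := hmass n p q hp hq
      rw [← volume_real_level_prod C n p q] at h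
      rw [← ENNReal.ofReal_toReal (volume_inter_level_prod_ne_top A n p q),
        ← ENNReal.ofReal_toReal (C.volume_level_prod_ne_top n p q), ← ENNReal.ofReal_mul hρ]
      exact congrArg ENNReal.ofReal h
    · rw [Measure.restrict_apply hs.1, Measure.smul_apply, measure_prod_apply_of_disjoint hs.2,
        measure_prod_apply_of_disjoint (hs.2.mono_left Set.inter_subset_left), smul_zero]

lemma ergodic_prodMap_transformation (hC : C.HasAllUniquePairs) :
    Ergodic (Prod.map C.transformation C.transformation) (C.measure.prod C.measure) := by
  have : SFinite C.measure := by unfold RankOneConstruction.measure; infer_instance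
  refine ⟨C.measurePreserving_transformation.prod C.measurePreserving_transformation,
    ⟨fun A hA hinv => ?_⟩⟩
  obtain ⟨ρ, hρ⟩ := exists_restrict_eq_smul hC hA hinv
  -- On `Aᶜ` the restricted measure vanishes, so `ρ = 0` or `Aᶜ` is null.
  have h := congrArg (fun ν => ν Aᶜ) hρ
  simp only [Measure.restrict_apply hA.compl, Set.compl_inter_self, measure_empty,
    Measure.smul_apply, smul_eq_mul] at h
  rw [Filter.eventuallyConst_set']
  rcases mul_eq_zero.1 h.symm with rfl | h
  · left
    rw [zero_smul, Measure.restrict_eq_zero] at hρ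
    exact ae_eq_empty.2 hρ
  · right
    exact ae_eq_univ.2 h

lemma conservative_prodMap_transformation (hC : C.HasAllUniquePairs) :
    Conservative (Prod.map C.transformation C.transformation) (C.measure.prod C.measure) := by
  have h : NullSingletonClass (C.measure.prod C.measure) := by
    rw [measure_prod_measure]
    infer_instance
  -- An injective Borel map of the plane is a measurable embedding (Lusin–Souslin).
  exact (ergodic_prodMap_transformation hC).conservative_of_measurableEmbedding
    ((C.measurable_transformation.prodMap C.measurable_transformation).measurableEmbedding
      (C.transformation_injective.prodMap C.transformation_injective))

end RankOneConstruction

theorem propositionP (C : RankOneConstruction)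
    (hC : ∀ ε : ℝ, 0 < ε → ∀ i b : ℕ, (b : ℤ) < (C.height i : ℤ) - 1 →
      ∃ j : ℕ, i < j ∧ C.HasUniquePairs ε i b j) :
    Conservative (Prod.map C.transformation C.transformation) (C.measure.prod C.measure) ∧
      Ergodic (Prod.map C.transformation C.transformation) (C.measure.prod C.measure) :=
  ⟨RankOneConstruction.conservative_prodMap_transformation hC,
    RankOneConstruction.ergodic_prodMap_transformation hC⟩
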